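/- Theorem (Lipschitz norm of the Kantorovich–Rubinstein dual). Let $n \in \mathbb{N}$, let $M \subseteq \mathbb{R}^n$ be a Borel set, and let $P_r$ and $P_\theta$ be Borel probability measures on $\mathbb{R}^n$ with $P_r(M) = P_\theta(M) = 1$. Let $\Pi$ be the set of transport plans, that is, of the Borel measures on $\mathbb{R}^n \times \mathbb{R}^n$ with first marginal $P_r$ and second marginal $P_\theta$, and let $\gamma^* \in \Pi$ be an optimal transport plan: $$\int \|x-y\|_2 \, d\gamma^*(x,y) = \inf_{\gamma \in \Pi} \int \|x-y\|_2 \, d\gamma(x,y) \in [0,\infty].$$ Call a function $f$ a critic if it is $1$-Lipschitz on $M$ with respect to $\|\cdot\|_2$ and integrable with respect to both $P_r$ and $P_\theta$. Let $f^*$ be an optimal critic, that is, a critic that maximises $$\mathbb{E}_{x \sim P_r} f(x) - \mathbb{E}_{y \sim P_\theta} f(y)$$ over all critics $f$, and suppose that $f^*$ is differentiable on $M$. Then $$f^*(x) - f^*(y) = \|x-y\|_2 \quad \text{for } \gamma^*\text{-almost every } (x,y).$$ -/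

import Mathlib

open MeasureTheory
open scoped ENNReal

noncomputable section

/-- `γ` is a transport plan (coupling) between `μ` and `ν`: a joint distribution with
first marginal `μ` and second marginal `ν`. -/
def IsTransportPlan {n : ℕ} (μ ν : Measure (EuclideanSpace ℝ (Fin n)))
    (γ : Measure (EuclideanSpace ℝ (Fin n) × EuclideanSpace ℝ (Fin n))) : Prop :=
  γ.map Prod.fst = μ ∧ γ.map Prod.snd = ν

/-- The expected Euclidean distance `E_{(x,y) ∼ γ} ‖x - y‖₂`, with value in `[0, ∞]`. -/
def transportCost {n : ℕ}
    (γ : Measure (EuclideanSpace ℝ (Fin n) × EuclideanSpace ℝ (Fin n))) : ℝ≥0∞ :=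
  ∫⁻ p, ‖p.1 - p.2‖ₑ ∂γ

/-- The Wasserstein distance: the infimum of the cost over all transport plans. -/
def wassersteinDistance {n : ℕ} (μ ν : Measure (EuclideanSpace ℝ (Fin n))) : ℝ≥0∞ :=
  ⨅ (γ : Measure (EuclideanSpace ℝ (Fin n) × EuclideanSpace ℝ (Fin n)))
    (_ : IsTransportPlan μ ν γ), transportCost γ

/-- A transport plan that attains the infimum. -/
def IsOptimalTransportPlan {n : ℕ} (μ ν : Measure (EuclideanSpace ℝ (Fin n)))
    (γ : Measure (EuclideanSpace ℝ (Fin n) × EuclideanSpace ℝ (Fin n))) : Prop :=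
  IsTransportPlan μ ν γ ∧ transportCost γ = wassersteinDistance μ ν

/-- Admissible critics on `M`: functions that are 1-Lipschitz on `M` for the Euclidean norm and
whose two expectations are defined. -/
def IsCritic {n : ℕ} (M : Set (EuclideanSpace ℝ (Fin n)))
    (μ ν : Measure (EuclideanSpace ℝ (Fin n))) (f : EuclideanSpace ℝ (Fin n) → ℝ) : Prop :=
  LipschitzOnWith 1 f M ∧ Integrable f μ ∧ Integrable f ν

/-- The Kantorovich–Rubinstein dual objective `E_{x ∼ μ} f(x) - E_{y ∼ ν} f(y)`. -/
def dualObjective {n : ℕ} (μ ν : Measure (EuclideanSpace ℝ (Fin n)))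
    (f : EuclideanSpace ℝ (Fin n) → ℝ) : ℝ :=
  (∫ x, f x ∂μ) - ∫ y, f y ∂ν

/-- A critic that maximises the Kantorovich–Rubinstein dual objective among all critics. -/
def IsOptimalCritic {n : ℕ} (M : Set (EuclideanSpace ℝ (Fin n)))
    (μ ν : Measure (EuclideanSpace ℝ (Fin n))) (f : EuclideanSpace ℝ (Fin n) → ℝ) : Prop :=
  IsCritic M μ ν f ∧ ∀ g, IsCritic M μ ν g → dualObjective μ ν g ≤ dualObjective μ ν f

end

/-!
The proof shows that an optimal critic attains the transport cost (Kantorovich–Rubinstein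
duality) and then uses complementary slackness.

Let `D` be the value of the dual problem. Bounded `1`-Lipschitz functions are critics, so
`∫ g dμ - ∫ g dν ≤ D` for each of them. Inf-convolution turns this into the inequality
`∫ a dμ + ∫ b dν + t D ≥ 0` whenever `t ≥ 0` and `a x + b y + t |x - y| ≥ 0`
(`integral_add_integral_add_mul_nonneg`). The M. Riesz extension theorem then gives a positive
functional on the bounded continuous functions of `(x, y)` which has marginals `μ` and `ν` and is
at most `D` on each minorant of the distance (`exists_positive_functional`). By the
Riesz–Markov–Kakutani theorem and tightness of the marginals this functional is a measure
(`exists_measure_of_functional`), that is, a coupling of cost at most `D`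
(`exists_coupling_lintegral_edist_le`). Only truncations of the distance are integrated before
the last step, so finiteness of the transport cost need not be known beforehand: it follows from
the existence of an optimal critic.

For an optimal plan `γ` and an optimal critic `f` this gives
`∫ ‖x - y‖ dγ ≤ ∫ (f x - f y) dγ`. As `f` is `1`-Lipschitz on `M`, which carries both marginals,
`‖x - y‖ - (f x - f y)` is nonnegative almost everywhere with integral at most `0`, so it
vanishes almost everywhere.
-/

open BoundedContinuousFunction Filter Topology
open scoped NNReal CompactlySupported

/-! ### Cutoff functions -/

section Cutoff

variable {X : Type*} [NormedAddCommGroup X]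

variable (X) in
/-- The continuous cutoff that equals `1` on the ball of radius `k` and `0` off the ball of
radius `k + 1`. -/
noncomputable def cutoff (k : ℕ) : X →ᵇ ℝ :=
  BoundedContinuousFunction.ofNormedAddCommGroup (fun x => max 0 (min 1 (k + 1 - ‖x‖)))
    (by fun_prop) 1 fun x => by
      rw [Real.norm_eq_abs, abs_of_nonneg (le_max_left _ _)]
      exact max_le zero_le_one (min_le_left _ _)

lemma cutoff_apply (k : ℕ) (x : X) : cutoff X k x = max 0 (min 1 (k + 1 - ‖x‖)) := rfl

lemma cutoff_nonneg (k : ℕ) (x : X) : 0 ≤ cutoff X k x := le_max_left _ _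

lemma cutoff_le_one (k : ℕ) (x : X) : cutoff X k x ≤ 1 := max_le zero_le_one (min_le_left _ _)

lemma cutoff_eq_one {k : ℕ} {x : X} (h : ‖x‖ ≤ k) : cutoff X k x = 1 := by
  rw [cutoff_apply, min_eq_left (by linarith), max_eq_right zero_le_one]

lemma cutoff_eq_zero {k : ℕ} {x : X} (h : k + 1 ≤ ‖x‖) : cutoff X k x = 0 := by
  rw [cutoff_apply, max_eq_left]
  exact (min_le_right _ _).trans (by linarith)

lemma tendsto_cutoff (x : X) : Tendsto (fun k => cutoff X k x) atTop (𝓝 1) := by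
  obtain ⟨N, hN⟩ := exists_nat_ge ‖x‖
  refine tendsto_const_nhds.congr' ?_
  filter_upwards [eventually_ge_atTop N] with k hk
  exact (cutoff_eq_one (hN.trans (by exact_mod_cast hk))).symm

variable (X) in
/-- The product cutoff `(x, y) ↦ cutoff x * cutoff y`, which has compact support in `X × X`. -/
noncomputable def prodCutoff (k : ℕ) : X × X →ᵇ ℝ :=
  (cutoff X k).compContinuous ⟨Prod.fst, continuous_fst⟩ *
    (cutoff X k).compContinuous ⟨Prod.snd, continuous_snd⟩

lemma prodCutoff_apply (k : ℕ) (p : X × X) :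
    prodCutoff X k p = cutoff X k p.1 * cutoff X k p.2 := rfl

lemma prodCutoff_nonneg (k : ℕ) (p : X × X) : 0 ≤ prodCutoff X k p :=
  mul_nonneg (cutoff_nonneg k _) (cutoff_nonneg k _)

lemma prodCutoff_le_one (k : ℕ) (p : X × X) : prodCutoff X k p ≤ 1 :=
  mul_le_one₀ (cutoff_le_one k _) (cutoff_nonneg k _) (cutoff_le_one k _)

lemma tendsto_prodCutoff (p : X × X) : Tendsto (fun k => prodCutoff X k p) atTop (𝓝 1) := by
  simpa [prodCutoff_apply] using (tendsto_cutoff p.1).mul (tendsto_cutoff p.2)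

lemma hasCompactSupport_prodCutoff [ProperSpace X] (k : ℕ) :
    HasCompactSupport (prodCutoff X k) := by
  refine HasCompactSupport.intro (isCompact_closedBall (0 : X × X) (k + 1)) fun p hp => ?_
  rw [mem_closedBall_zero_iff, not_le, Prod.norm_def, lt_max_iff] at hp
  rw [prodCutoff_apply]
  rcases hp with hp | hp <;> simp [cutoff_eq_zero hp.le]

lemma tendsto_integral_cutoff [MeasurableSpace X] [BorelSpace X]
    (μ : Measure X) [IsProbabilityMeasure μ] :
    Tendsto (fun k => ∫ x, cutoff X k x ∂μ) atTop (𝓝 1) := by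
  have h := tendsto_integral_of_dominated_convergence (μ := μ) (F := fun k x => cutoff X k x)
    (f := fun _ => (1 : ℝ)) (fun _ => 1) (fun k => (cutoff X k).continuous.aestronglyMeasurable)
    (integrable_const _)
    (fun k => ae_of_all _ fun x => by
      rw [Real.norm_eq_abs, abs_of_nonneg (cutoff_nonneg k x)]; exact cutoff_le_one k x)
    (ae_of_all _ tendsto_cutoff)
  simpa using h

end Cutoff

/-! ### A positive functional from the dual bound -/

section Duality

variable {X : Type*} [NormedAddCommGroup X] [MeasurableSpace X]

/-- The dual bound, rescaled to `t`-Lipschitz functions. -/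
lemma integral_sub_le_mul_of_lipschitz {μ ν : Measure X} [IsProbabilityMeasure μ]
    [IsProbabilityMeasure ν] {D : ℝ}
    (hD : ∀ g : X →ᵇ ℝ, LipschitzWith 1 g → ∫ x, g x ∂μ - ∫ x, g x ∂ν ≤ D)
    {t : ℝ≥0} {g : X →ᵇ ℝ} (hg : LipschitzWith t g) :
    ∫ x, g x ∂μ - ∫ x, g x ∂ν ≤ t * D := by
  rcases eq_or_ne t 0 with rfl | ht
  · -- A `0`-Lipschitz function is constant.
    have h0 : ∀ x, g x = g 0 := fun x => by
      have := hg.dist_le_mul x 0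
      simpa using this
    simp [h0]
  · have hl : LipschitzWith 1 ((t : ℝ)⁻¹ • g) := by
      refine LipschitzWith.of_dist_le_mul fun x y => ?_
      have h := hg.dist_le_mul x y
      have htp : (0 : ℝ) < t := by positivity
      simp only [BoundedContinuousFunction.coe_smul, dist_smul₀, Real.norm_eq_abs, abs_inv,
        NNReal.abs_eq, NNReal.coe_one, one_mul]
      rwa [inv_mul_le_iff₀ htp]
    have h := hD _ hl
    simp only [BoundedContinuousFunction.coe_smul, smul_eq_mul, integral_const_mul] at h
    have htp : (0 : ℝ) < t := by positivity
    rw [← mul_sub, inv_mul_le_iff₀ htp] at h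
    exact h

variable [BorelSpace X]

/-- The nonnegativity hypothesis of the Riesz extension theorem. The inf-convolution
`g y = ⨅ x, a x + t * dist x y` is `t`-Lipschitz and satisfies `-b ≤ g ≤ a`, so the dual bound
for `-g` gives the claim. -/
lemma integral_add_integral_add_mul_nonneg {μ ν : Measure X} [IsProbabilityMeasure μ]
    [IsProbabilityMeasure ν] {D : ℝ}
    (hD : ∀ g : X →ᵇ ℝ, LipschitzWith 1 g → ∫ x, g x ∂μ - ∫ x, g x ∂ν ≤ D)
    (a b : X →ᵇ ℝ) {t : ℝ≥0} (h : ∀ x y, 0 ≤ a x + b y + t * dist x y) :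
    0 ≤ ∫ x, a x ∂μ + ∫ y, b y ∂ν + t * D := by
  have hbdd : ∀ y, BddBelow (Set.range fun x => a x + t * dist x y) := fun y =>
    ⟨-b y, by rintro _ ⟨x, rfl⟩; linarith [h x y]⟩
  set g : X → ℝ := fun y => ⨅ x, a x + t * dist x y
  have hga : ∀ y, g y ≤ a y := fun y => (ciInf_le (hbdd y) y).trans (by simp)
  have hgb : ∀ y, -b y ≤ g y := fun y => le_ciInf fun x => by linarith [h x y]
  have hlip : LipschitzWith t g := by
    refine LipschitzWith.of_le_add_mul _ fun y z => ?_
    rw [← sub_le_iff_le_add]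
    refine le_ciInf fun x => ?_
    have h1 := ciInf_le (hbdd y) x
    have h2 := mul_le_mul_of_nonneg_left (dist_triangle x z y) t.2
    rw [dist_comm y z]
    change g y - (t : ℝ) * dist z y ≤ _
    change g y ≤ _ at h1
    change (t : ℝ) * _ ≤ (t : ℝ) * _ at h2
    linarith
  let G : X →ᵇ ℝ := BoundedContinuousFunction.ofNormedAddCommGroup g hlip.continuous
    (max ‖a‖ ‖b‖) fun y => by
      have h1 := (abs_le.1 (a.norm_coe_le_norm y)).2
      have h2 := (abs_le.1 (b.norm_coe_le_norm y)).2
      rw [Real.norm_eq_abs, abs_le]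
      constructor
      · linarith [hgb y, le_max_right ‖a‖ ‖b‖]
      · linarith [hga y, le_max_left ‖a‖ ‖b‖]
  have hG : LipschitzWith t (-G) := hlip.neg
  have h1 := integral_sub_le_mul_of_lipschitz hD hG
  have h2 : ∫ x, G x ∂μ ≤ ∫ x, a x ∂μ := integral_mono (G.integrable μ) (a.integrable μ) hga
  have h3 : ∫ y, -b y ∂ν ≤ ∫ y, G y ∂ν :=
    integral_mono (b.integrable ν).neg (G.integrable ν) hgb
  simp only [BoundedContinuousFunction.coe_neg, Pi.neg_apply, integral_neg] at h1 h3
  linarith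

variable (X) in
/-- The convex cone of quadruples `(a, b, t, h)` with `t ≥ 0` and
`a x + b y + t * dist x y + h (x, y) ≥ 0` for all `x` and `y`. -/
def dualCone : PointedCone ℝ ((((X →ᵇ ℝ) × (X →ᵇ ℝ)) × ℝ) × (X × X →ᵇ ℝ)) where
  carrier := {u | 0 ≤ u.1.2 ∧ ∀ x y, 0 ≤ u.1.1.1 x + u.1.1.2 y + u.1.2 * dist x y + u.2 (x, y)}
  add_mem' := by
    rintro u v ⟨hu, hu'⟩ ⟨hv, hv'⟩
    refine ⟨add_nonneg hu hv, fun x y => ?_⟩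
    have h1 := hu' x y
    have h2 := hv' x y
    simp only [Prod.fst_add, Prod.snd_add, BoundedContinuousFunction.coe_add, Pi.add_apply]
    linarith
  zero_mem' := by simp
  smul_mem' := by
    rintro c u ⟨hu, hu'⟩
    refine ⟨mul_nonneg c.2 hu, fun x y => ?_⟩
    have h1 := mul_nonneg c.2 (hu' x y)
    change 0 ≤ (c : ℝ) * u.1.1.1 x + (c : ℝ) * u.1.1.2 y + (c : ℝ) * u.1.2 * dist x y
      + (c : ℝ) * u.2 (x, y)
    linarith

/-- The functional `(a, b, t, h) ↦ ∫ a ∂μ + ∫ b ∂ν + t * D`. -/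
noncomputable def marginalFunctional (μ ν : Measure X) [IsProbabilityMeasure μ]
    [IsProbabilityMeasure ν] (D : ℝ) : ((((X →ᵇ ℝ) × (X →ᵇ ℝ)) × ℝ) × (X × X →ᵇ ℝ)) →ₗ[ℝ] ℝ where
  toFun u := ∫ x, u.1.1.1 x ∂μ + ∫ y, u.1.1.2 y ∂ν + u.1.2 * D
  map_add' u v := by
    simp only [Prod.fst_add, Prod.snd_add, BoundedContinuousFunction.coe_add, Pi.add_apply]
    rw [integral_add (u.1.1.1.integrable μ) (v.1.1.1.integrable μ),
      integral_add (u.1.1.2.integrable ν) (v.1.1.2.integrable ν)]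
    ring
  map_smul' c u := by
    simp only [Prod.smul_fst, Prod.smul_snd, BoundedContinuousFunction.coe_smul, smul_eq_mul,
      integral_const_mul, RingHom.id_apply]
    ring

/-- A functional that behaves like integration against a coupling of cost at most `D`, obtained
by extending `marginalFunctional` from the subspace `h = 0` so that it stays nonnegative on
`dualCone`. -/
lemma exists_positive_functional {μ ν : Measure X} [IsProbabilityMeasure μ]
    [IsProbabilityMeasure ν] {D : ℝ}
    (hD : ∀ g : X →ᵇ ℝ, LipschitzWith 1 g → ∫ x, g x ∂μ - ∫ x, g x ∂ν ≤ D) :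
    ∃ L : (X × X →ᵇ ℝ) →ₗ[ℝ] ℝ, (∀ h, (∀ p, 0 ≤ h p) → 0 ≤ L h) ∧
      (∀ (a b : X →ᵇ ℝ) (h : X × X →ᵇ ℝ), (∀ p, h p = a p.1 + b p.2) →
        L h = ∫ x, a x ∂μ + ∫ y, b y ∂ν) ∧
      ∀ h : X × X →ᵇ ℝ, (∀ p, h p ≤ dist p.1 p.2) → L h ≤ D := by
  obtain ⟨G, hG, hpos⟩ := riesz_extension (dualCone X)
    ((marginalFunctional μ ν D).toPMap
      (LinearMap.ker (LinearMap.snd ℝ (((X →ᵇ ℝ) × (X →ᵇ ℝ)) × ℝ) (X × X →ᵇ ℝ))))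
    (by
      rintro ⟨⟨⟨⟨a, b⟩, t⟩, h⟩, hu⟩ ⟨ht, hs⟩
      obtain rfl : h = 0 := hu
      lift t to ℝ≥0 using ht
      exact integral_add_integral_add_mul_nonneg hD a b fun x y => by simpa using hs x y)
    (by
      -- A large constant in place of `a` dominates every bounded function.
      rintro ⟨⟨⟨a, b⟩, t⟩, h⟩
      refine ⟨⟨⟨⟨⟨BoundedContinuousFunction.const X (‖a‖ + ‖b‖ + ‖h‖), 0⟩, -t⟩, 0⟩, rfl⟩,
        ?_, fun x y => ?_⟩
      · simp
      · have h1 := (abs_le.1 (a.norm_coe_le_norm x)).1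
        have h2 := (abs_le.1 (b.norm_coe_le_norm y)).1
        have h3 := (abs_le.1 (h.norm_coe_le_norm (x, y))).1
        simp only [Prod.mk_add_mk, BoundedContinuousFunction.coe_add, Pi.add_apply,
          BoundedContinuousFunction.const_apply, zero_add, neg_add_cancel,
          zero_mul, add_zero]
        linarith)
  have hG' : ∀ a b t, G (((a, b), t), 0) = ∫ x, a x ∂μ + ∫ y, b y ∂ν + t * D :=
    fun a b t => hG ⟨(((a, b), t), 0), rfl⟩
  have hsplit : ∀ u h, G (u, h) = G (u, 0) + G (0, h) := fun u h => by
    rw [← map_add]; simp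
  refine ⟨G ∘ₗ LinearMap.inr ℝ _ _, fun h hh => hpos _ ⟨le_rfl, fun x y => by simpa using hh _⟩,
    fun a b h hh => ?_, fun h hh => ?_⟩
  · have h1 : 0 ≤ G (((-a, -b), 0), h) := hpos _ ⟨le_rfl, fun x y => by
      simp [hh]; linarith⟩
    have h2 : 0 ≤ G (((a, b), 0), -h) := hpos _ ⟨le_rfl, fun x y => by simp [hh]⟩
    have h3 : G (0, -h) = -G (0, h) := by rw [← map_neg]; simp
    rw [hsplit, hG'] at h1 h2
    simp only [BoundedContinuousFunction.coe_neg, Pi.neg_apply, integral_neg] at h1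
    simp only [LinearMap.comp_apply, LinearMap.inr_apply]
    linarith
  · have h1 : 0 ≤ G (((0, 0), 1), -h) := hpos _ ⟨zero_le_one, fun x y => by
      simpa using hh (x, y)⟩
    have h3 : G (0, -h) = -G (0, h) := by rw [← map_neg]; simp
    rw [hsplit, hG'] at h1
    simp at h1
    simp only [LinearMap.comp_apply, LinearMap.inr_apply]
    linarith

/-! ### Representing the functional by a coupling -/

variable [ProperSpace X]

/-- A positive functional on `Cb(X × X)` with marginals `μ` and `ν` is integration against a
measure. The representing measure on `Cc(X × X)` loses no mass at infinity because the marginals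
are tight. -/
lemma exists_measure_of_functional {μ ν : Measure X} [IsProbabilityMeasure μ]
    [IsProbabilityMeasure ν] (L : (X × X →ᵇ ℝ) →ₗ[ℝ] ℝ)
    (hpos : ∀ h, (∀ p, 0 ≤ h p) → 0 ≤ L h)
    (hmarg : ∀ (a b : X →ᵇ ℝ) (h : X × X →ᵇ ℝ), (∀ p, h p = a p.1 + b p.2) →
        L h = ∫ x, a x ∂μ + ∫ y, b y ∂ν) :
    ∃ π : Measure (X × X), IsFiniteMeasure π ∧ ∀ h : X × X →ᵇ ℝ, ∫ p, h p ∂π = L h := by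
  have hmono : ∀ h h' : X × X →ᵇ ℝ, (∀ p, h p ≤ h' p) → L h ≤ L h' := fun h h' hh => by
    have := hpos (h' - h) fun p => by simpa using hh p
    rw [map_sub] at this
    linarith
  have hone : L 1 = 1 := by
    have := hmarg 1 0 1 (by simp)
    simpa using this
  -- The inclusion of `C_c(X × X, ℝ)` into the bounded continuous functions.
  let toB : C_c(X × X, ℝ) →ₗ[ℝ] (X × X →ᵇ ℝ) :=
    { toFun := fun f => ⟨f.toContinuousMap, by
        obtain ⟨C, hC⟩ := f.hasCompactSupport.exists_bound_of_continuous f.continuous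
        refine ⟨2 * C, fun p q => ?_⟩
        rw [dist_eq_norm]
        refine (norm_sub_le _ _).trans ?_
        have h1 := hC p
        have h2 := hC q
        change ‖f p‖ + ‖f q‖ ≤ _
        linarith⟩
      map_add' := fun f g => rfl
      map_smul' := fun c f => rfl }
  let Λ : C_c(X × X, ℝ) →ₚ[ℝ] ℝ := PositiveLinearMap.mk₀ (L ∘ₗ toB) fun f hf => hpos _ hf
  let π := RealRMK.rieszMeasure Λ
  have hrep : ∀ (k : ℕ) (h : X × X →ᵇ ℝ),
      ∫ p, h p * prodCutoff X k p ∂π = L (h * prodCutoff X k) := fun k h => by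
    have := RealRMK.integral_rieszMeasure Λ
      ⟨(h * prodCutoff X k).toContinuousMap, (hasCompactSupport_prodCutoff k).mul_left⟩
    exact this
  -- Each cutoff has integral at most `L 1 = 1`, hence so has their increasing limit `1`.
  have hfin : IsFiniteMeasure π := by
    refine ⟨lt_of_le_of_lt ?_ ENNReal.one_lt_top⟩
    have hlim : Tendsto (fun k => ∫⁻ p, ENNReal.ofReal (prodCutoff X k p) ∂π) atTop
        (𝓝 (∫⁻ _, 1 ∂π)) := by
      refine lintegral_tendsto_of_tendsto_of_monotone
        (fun k => (by fun_prop : Measurable _).aemeasurable) (ae_of_all _ fun p k l hkl => ?_)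
        (ae_of_all _ fun p => ?_)
      · refine ENNReal.ofReal_le_ofReal ?_
        have : (k : ℝ) ≤ l := by exact_mod_cast hkl
        have hc : ∀ x, cutoff X k x ≤ cutoff X l x := fun x => by
          rw [cutoff_apply, cutoff_apply]
          gcongr
        exact mul_le_mul (hc _) (hc _) (cutoff_nonneg _ _) (cutoff_nonneg _ _)
      · simpa using ENNReal.tendsto_ofReal (tendsto_prodCutoff p)
    rw [lintegral_one] at hlim
    refine le_of_tendsto' hlim fun k => ?_
    have hint : Integrable (prodCutoff X k) π :=
      (prodCutoff X k).continuous.integrable_of_hasCompactSupport (hasCompactSupport_prodCutoff k)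
    rw [← ofReal_integral_eq_lintegral_ofReal hint (ae_of_all _ (prodCutoff_nonneg k))]
    have h1 := hrep k 1
    simp only [BoundedContinuousFunction.coe_one, Pi.one_apply, one_mul] at h1
    rw [h1, ← ENNReal.ofReal_one, ← hone]
    exact ENNReal.ofReal_le_ofReal (hmono _ _ (prodCutoff_le_one k))
  refine ⟨π, hfin, fun h => ?_⟩
  have hlim1 : Tendsto (fun k => L (h * prodCutoff X k)) atTop (𝓝 (∫ p, h p ∂π)) := by
    simp_rw [← hrep]
    refine tendsto_integral_of_dominated_convergence (fun _ => ‖h‖)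
      (fun k => (h * prodCutoff X k).continuous.aestronglyMeasurable) (integrable_const _)
      (fun k => ae_of_all _ fun p => ?_) (ae_of_all _ fun p => ?_)
    · rw [norm_mul, Real.norm_of_nonneg (prodCutoff_nonneg k p)]
      exact (mul_le_of_le_one_right (norm_nonneg _) (prodCutoff_le_one k p)).trans
        (h.norm_coe_le_norm p)
    · simpa using (tendsto_prodCutoff p).const_mul (h p)
  -- `|h - h * prodCutoff|` is dominated by a sum of functions of one variable, whose integrals
  -- against the marginals vanish in the limit.
  have hbound : ∀ k, |L h - L (h * prodCutoff X k)| ≤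
      ‖h‖ * ((1 - ∫ x, cutoff X k x ∂μ) + (1 - ∫ y, cutoff X k y ∂ν)) := fun k => by
    let e : X × X →ᵇ ℝ :=
      (1 - cutoff X k).compContinuous ⟨Prod.fst, continuous_fst⟩ +
        (1 - cutoff X k).compContinuous ⟨Prod.snd, continuous_snd⟩
    have he : ∀ p, e p = (1 - cutoff X k p.1) + (1 - cutoff X k p.2) := fun p => rfl
    have hLe : L e = (1 - ∫ x, cutoff X k x ∂μ) + (1 - ∫ y, cutoff X k y ∂ν) := by
      rw [hmarg (1 - cutoff X k) (1 - cutoff X k) e fun p => rfl]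
      have hi : ∀ (m : Measure X) [IsProbabilityMeasure m],
          ∫ x, (1 - cutoff X k) x ∂m = 1 - ∫ x, cutoff X k x ∂m := fun m _ => by
        simp only [BoundedContinuousFunction.coe_sub, Pi.sub_apply,
          BoundedContinuousFunction.coe_one, Pi.one_apply]
        rw [integral_sub (integrable_const _) ((cutoff X k).integrable m)]
        simp
      rw [hi, hi]
    have hpt : ∀ p, |h p - h p * prodCutoff X k p| ≤ ‖h‖ * e p := fun p => by
      have h1 : h p - h p * prodCutoff X k p = h p * (1 - prodCutoff X k p) := by ring
      rw [h1, abs_mul, abs_of_nonneg (sub_nonneg.2 (prodCutoff_le_one k p))]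
      refine mul_le_mul (h.norm_coe_le_norm p) ?_ (sub_nonneg.2 (prodCutoff_le_one k p))
        (norm_nonneg _)
      rw [he, prodCutoff_apply]
      nlinarith [mul_nonneg (sub_nonneg.2 (cutoff_le_one k p.1))
        (sub_nonneg.2 (cutoff_le_one k p.2))]
    rw [← hLe, ← smul_eq_mul ‖h‖ (L e), ← map_smul, ← map_sub, abs_le, ← map_neg]
    exact ⟨hmono _ _ fun p => (abs_le.1 (hpt p)).1, hmono _ _ fun p => (abs_le.1 (hpt p)).2⟩
  have hlim2 : Tendsto (fun k => L (h * prodCutoff X k)) atTop (𝓝 (L h)) := by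
    rw [tendsto_iff_dist_tendsto_zero]
    refine squeeze_zero (fun _ => dist_nonneg)
      (fun k => (dist_comm _ _).trans_le (hbound k)) ?_
    have := (((tendsto_integral_cutoff μ).const_sub 1).add
      ((tendsto_integral_cutoff ν).const_sub 1)).const_mul ‖h‖
    simpa using this
  exact tendsto_nhds_unique hlim1 hlim2

/-- Kantorovich–Rubinstein duality, the hard inequality: a bound on the dual problem over bounded
`1`-Lipschitz functions yields a coupling whose cost obeys that bound. -/
theorem exists_coupling_lintegral_edist_le {μ ν : Measure X} [IsProbabilityMeasure μ]
    [IsProbabilityMeasure ν] {D : ℝ}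
    (hD : ∀ g : X →ᵇ ℝ, LipschitzWith 1 g → ∫ x, g x ∂μ - ∫ x, g x ∂ν ≤ D) :
    ∃ π : Measure (X × X), π.map Prod.fst = μ ∧ π.map Prod.snd = ν ∧
      ∫⁻ p, ‖p.1 - p.2‖ₑ ∂π ≤ ENNReal.ofReal D := by
  obtain ⟨L, hpos, hmarg, hcost⟩ := exists_positive_functional hD
  obtain ⟨π, hfin, hπ⟩ := exists_measure_of_functional L hpos hmarg
  refine ⟨π, ?_, ?_, ?_⟩
  · refine ext_of_forall_integral_eq_of_IsFiniteMeasure fun a => ?_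
    rw [integral_map measurable_fst.aemeasurable a.continuous.aestronglyMeasurable]
    refine (hπ (a.compContinuous ⟨Prod.fst, continuous_fst⟩)).trans ?_
    rw [hmarg a 0 _ (by simp)]
    simp
  · refine ext_of_forall_integral_eq_of_IsFiniteMeasure fun b => ?_
    rw [integral_map measurable_snd.aemeasurable b.continuous.aestronglyMeasurable]
    refine (hπ (b.compContinuous ⟨Prod.snd, continuous_snd⟩)).trans ?_
    rw [hmarg 0 b _ (by simp)]
    simp
  · -- The distance is the increasing limit of its bounded truncations.
    have hlim : Tendsto (fun k : ℕ => ∫⁻ p, ENNReal.ofReal (min ‖p.1 - p.2‖ k) ∂π) atTop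
        (𝓝 (∫⁻ p, ‖p.1 - p.2‖ₑ ∂π)) := by
      refine lintegral_tendsto_of_tendsto_of_monotone
        (fun k => (by fun_prop : Measurable _).aemeasurable) (ae_of_all _ fun p k l hkl => ?_)
        (ae_of_all _ fun p => ?_)
      · refine ENNReal.ofReal_le_ofReal ?_
        have : (k : ℝ) ≤ l := by exact_mod_cast hkl
        gcongr
      · obtain ⟨N, hN⟩ := exists_nat_ge ‖p.1 - p.2‖
        refine tendsto_const_nhds.congr' ?_
        filter_upwards [eventually_ge_atTop N] with k hk
        have : (N : ℝ) ≤ k := by exact_mod_cast hk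
        rw [min_eq_left (hN.trans this), ofReal_norm]
    refine le_of_tendsto' hlim fun k => ?_
    let c : X × X →ᵇ ℝ := BoundedContinuousFunction.ofNormedAddCommGroup
      (fun p => min ‖p.1 - p.2‖ k) (by fun_prop) k fun p => by
        rw [Real.norm_of_nonneg (by positivity)]
        exact min_le_right _ _
    have hc0 : ∀ p, 0 ≤ c p := fun p => le_min (norm_nonneg _) (Nat.cast_nonneg _)
    have h1 := ofReal_integral_eq_lintegral_ofReal (c.integrable π) (ae_of_all _ hc0)
    refine h1.symm.trans_le (ENNReal.ofReal_le_ofReal ?_)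
    rw [hπ]
    exact hcost c fun p => by rw [dist_eq_norm]; exact min_le_left _ _

end Duality

/-! ### Complementary slackness -/

theorem mainTheorem2 {n : ℕ} (M : Set (EuclideanSpace ℝ (Fin n))) (hM : MeasurableSet M)
    (Pr Pθ : Measure (EuclideanSpace ℝ (Fin n)))
    [IsProbabilityMeasure Pr] [IsProbabilityMeasure Pθ]
    (hPr : ∀ᵐ x ∂Pr, x ∈ M) (hPθ : ∀ᵐ y ∂Pθ, y ∈ M)
    (γ : Measure (EuclideanSpace ℝ (Fin n) × EuclideanSpace ℝ (Fin n)))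
    (hγ : IsOptimalTransportPlan Pr Pθ γ)
    (f : EuclideanSpace ℝ (Fin n) → ℝ)
    (hf : IsOptimalCritic M Pr Pθ f) (hdiff : DifferentiableOn ℝ f M) :
    ∀ᵐ p ∂γ, f p.1 - f p.2 = ‖p.1 - p.2‖ := by
  obtain ⟨⟨hfst, hsnd⟩, hopt⟩ := hγ
  obtain ⟨⟨hlip, hfr, hfθ⟩, hmax⟩ := hf
  have hcost : ∫⁻ p, ‖p.1 - p.2‖ₑ ∂γ ≤ ENNReal.ofReal (dualObjective Pr Pθ f) := by
    obtain ⟨π, h1, h2, h3⟩ := exists_coupling_lintegral_edist_le (μ := Pr) (ν := Pθ)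
      (D := dualObjective Pr Pθ f)
      fun g hg => hmax g ⟨hg.lipschitzOnWith, g.integrable _, g.integrable _⟩
    exact hopt.le.trans ((iInf₂_le π ⟨h1, h2⟩).trans h3)
  have hD : 0 ≤ dualObjective Pr Pθ f := by
    simpa [dualObjective] using hmax 0
      ⟨(LipschitzWith.const' (0 : ℝ)).lipschitzOnWith, integrable_zero _ _ _,
        integrable_zero _ _ _⟩
  have hd : Integrable (fun p : EuclideanSpace ℝ (Fin n) × EuclideanSpace ℝ (Fin n) =>
      ‖p.1 - p.2‖) γ := by
    refine Integrable.norm ⟨(by fun_prop : Measurable _).aestronglyMeasurable, ?_⟩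
    exact hcost.trans_lt ENNReal.ofReal_lt_top
  have hdle : ∫ p, ‖p.1 - p.2‖ ∂γ ≤ dualObjective Pr Pθ f := by
    rw [← ENNReal.ofReal_le_ofReal_iff hD,
      ofReal_integral_eq_lintegral_ofReal hd (ae_of_all _ fun p => norm_nonneg _)]
    simpa only [ofReal_norm] using hcost
  rw [← hfst] at hfr hPr
  rw [← hsnd] at hfθ hPθ
  have hf1 : Integrable (fun p => f p.1) γ := hfr.comp_measurable measurable_fst
  have hf2 : Integrable (fun p => f p.2) γ := hfθ.comp_measurable measurable_snd
  have hobj : dualObjective Pr Pθ f = ∫ p, (f p.1 - f p.2) ∂γ := by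
    rw [integral_sub hf1 hf2, dualObjective, ← hfst, ← hsnd,
      integral_map measurable_fst.aemeasurable hfr.1,
      integral_map measurable_snd.aemeasurable hfθ.1]
  have hnn : 0 ≤ᵐ[γ] fun p => ‖p.1 - p.2‖ - (f p.1 - f p.2) := by
    filter_upwards [ae_of_ae_map measurable_fst.aemeasurable hPr,
      ae_of_ae_map measurable_snd.aemeasurable hPθ] with p h1 h2
    have h := hlip.dist_le_mul p.1 h1 p.2 h2
    rw [Real.dist_eq, NNReal.coe_one, one_mul, dist_eq_norm] at h
    exact sub_nonneg.2 ((le_abs_self _).trans h)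
  have hint := hd.sub (hf1.sub hf2)
  have hzero : ∫ p, (‖p.1 - p.2‖ - (f p.1 - f p.2)) ∂γ = 0 := by
    refine le_antisymm ?_ (integral_nonneg_of_ae hnn)
    have := integral_sub hd (hf1.sub hf2)
    simp only [Pi.sub_apply] at this
    rw [this, ← hobj]
    linarith
  filter_upwards [(integral_eq_zero_iff_of_nonneg_ae hnn hint).1 hzero] with p hp
  simp only [Pi.zero_apply] at hp
  linarith
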